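/- Let $\theta\ge 2$ be the order type of a totally ordered set $J=\{0\}+I$ with least element $0$ (so $I$ is a nonempty chain). An $LM_\theta$-algebra is an algebra $\langle A,\vee,\wedge,0,1,\{\phi_i\}_{i\in I},\{\overline{\phi}_i\}_{i\in I}\rangle$ such that $\langle A,\vee,\wedge,0,1\rangle$ is a bounded distributive lattice and, for all $i,j\in I$ and $x,y\in A$: each $\phi_i$ is an endomorphism of bounded lattices; $\phi_i x\vee\overline{\phi}_i x=1$ and $\phi_i x\wedge\overline{\phi}_i x=0$; $\phi_i\phi_j x=\phi_j x$; $i\le j$ implies $\phi_i x\le\phi_j x$; and if $\phi_k x=\phi_k y$ for all $k\in I$, then $x=y$. A congruence on $A$ is an equivalence relation compatible with all the operations $\vee,\wedge,\phi_i,\overline{\phi}_i$. A $\theta$-congruence on $A$ is a bounded distributive lattice congruence $\vartheta$ on $A$ such that $(x,y)\in\vartheta$ if and only if $(\phi_i x,\phi_i y)\in\vartheta$ for all $i\in I$. Ordered by inclusion, the congruences form a lattice $Con_{LM_\theta}(A)$ and the $\theta$-congruences form a lattice $Con_{\theta LM_\theta}(A)$; in both, the least element is the equality relation, the greatest is $A\times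 A$, the meet is the intersection, and the join of two elements is the least congruence (respectively, $\theta$-congruence) containing both. A Boolean congruence is a complemented element of $Con_{LM_\theta}(A)$, and a Boolean $\theta$-congruence is a complemented element of $Con_{\theta LM_\theta}(A)$. Let $A$ be an $LM_\theta$-algebra and let $\varphi$ be a congruence on $A$. Then the following conditions are equivalent: (i) $\varphi$ is a Boolean congruence; (ii) $\varphi$ is a Boolean $\theta$-congruence. -/

import Mathlib

/-- A `θ`-valued Łukasiewicz–Moisil algebra structure on the bounded distributive lattice `A`,
where `θ` is the order type of the chain `J = {0} + I` (so `θ ≥ 2` means that `I` is nonempty).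
Condition (L1) is expressed by the type of `φ`. -/
class LMAlgebra (I : Type*) [LinearOrder I] (A : Type*) [DistribLattice A] [BoundedOrder A] where
  /-- the operations `φ i`, endomorphisms of the bounded lattice `A` -/
  φ : I → BoundedLatticeHom A A
  /-- the operations `φ̄ i` -/
  φbar : I → A → A
  φ_sup_φbar : ∀ (i : I) (x : A), φ i x ⊔ φbar i x = ⊤
  φ_inf_φbar : ∀ (i : I) (x : A), φ i x ⊓ φbar i x = ⊥
  φ_φ : ∀ (i j : I) (x : A), φ i (φ j x) = φ j x
  φ_mono : ∀ (i j : I) (x : A), i ≤ j → φ i x ≤ φ j x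
  determination : ∀ x y : A, (∀ i : I, φ i x = φ i y) → x = y

section Congruences

variable (I : Type*) [LinearOrder I] (A : Type*) [DistribLattice A] [BoundedOrder A]
  [LMAlgebra I A]

/-- The `LM_θ`-congruences of `A`: equivalence relations compatible with all operations of the
algebra. -/
structure LMCon extends LatticeCon A where
  φ : ∀ (i : I) {x y : A}, r x y → r (LMAlgebra.φ i x) (LMAlgebra.φ i y)
  φbar : ∀ (i : I) {x y : A}, r x y → r (LMAlgebra.φbar i x) (LMAlgebra.φbar i y)

/-- The `θ`-congruences of `A`: congruences `ϑ` of the bounded distributive lattice `A` such that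
`(x, y) ∈ ϑ` if and only if `(φ i x, φ i y) ∈ ϑ` for all `i`. -/
structure ThetaCon extends LatticeCon A where
  iff_forall_φ : ∀ x y : A, r x y ↔ ∀ i : I, r (LMAlgebra.φ i x) (LMAlgebra.φ i y)

variable {I A}

namespace LMCon

theorem ext_rel {c d : LMCon I A} (h : ∀ x y, c.r x y ↔ d.r x y) : c = d := by
  rcases c with ⟨⟨⟨r, _⟩, _, _⟩, _, _⟩
  rcases d with ⟨⟨⟨s, _⟩, _, _⟩, _, _⟩
  obtain rfl : r = s := by
    funext x y
    exact propext (h x y)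
  rfl

/-- Congruences are ordered by inclusion. -/
instance : PartialOrder (LMCon I A) where
  le c d := ∀ ⦃x y : A⦄, c.r x y → d.r x y
  le_refl _ _ _ h := h
  le_trans _ _ _ h₁ h₂ _ _ h := h₂ (h₁ h)
  le_antisymm _ _ h₁ h₂ := ext_rel fun _ _ => ⟨fun h => h₁ h, fun h => h₂ h⟩

/-- The infimum of a set of congruences is its intersection. -/
instance : InfSet (LMCon I A) where
  sInf S :=
    { r := fun x y => ∀ c ∈ S, c.r x y
      iseqv := ⟨fun x c _ => c.iseqv.refl x, fun h c hc => c.iseqv.symm (h c hc),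
        fun h₁ h₂ c hc => c.iseqv.trans (h₁ c hc) (h₂ c hc)⟩
      inf := fun h₁ h₂ c hc => c.inf (h₁ c hc) (h₂ c hc)
      sup := fun h₁ h₂ c hc => c.sup (h₁ c hc) (h₂ c hc)
      φ := fun i _ _ h c hc => c.φ i (h c hc)
      φbar := fun i _ _ h c hc => c.φbar i (h c hc) }

/-- The lattice `Con_{LM_θ}(A)`: meets are intersections, and the join of two congruences is the
least congruence that contains both. -/
instance : CompleteLattice (LMCon I A) :=
  completeLatticeOfInf _ fun _ =>
    ⟨fun c hc _ _ h => h c hc, fun _ hd _ _ h _ hc => hd hc h⟩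

/-- A Boolean congruence is a complemented element of the lattice `Con_{LM_θ}(A)`. -/
def IsBoolean (c : LMCon I A) : Prop := IsComplemented c

end LMCon

namespace ThetaCon

theorem ext_rel {c d : ThetaCon I A} (h : ∀ x y, c.r x y ↔ d.r x y) : c = d := by
  rcases c with ⟨⟨⟨r, _⟩, _, _⟩, _⟩
  rcases d with ⟨⟨⟨s, _⟩, _, _⟩, _⟩
  obtain rfl : r = s := by
    funext x y
    exact propext (h x y)
  rfl

/-- `θ`-congruences are ordered by inclusion. -/
instance : PartialOrder (ThetaCon I A) where
  le c d := ∀ ⦃x y : A⦄, c.r x y → d.r x y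
  le_refl _ _ _ h := h
  le_trans _ _ _ h₁ h₂ _ _ h := h₂ (h₁ h)
  le_antisymm _ _ h₁ h₂ := ext_rel fun _ _ => ⟨fun h => h₁ h, fun h => h₂ h⟩

/-- The infimum of a set of `θ`-congruences is its intersection. -/
instance : InfSet (ThetaCon I A) where
  sInf S :=
    { r := fun x y => ∀ c ∈ S, c.r x y
      iseqv := ⟨fun x c _ => c.iseqv.refl x, fun h c hc => c.iseqv.symm (h c hc),
        fun h₁ h₂ c hc => c.iseqv.trans (h₁ c hc) (h₂ c hc)⟩
      inf := fun h₁ h₂ c hc => c.inf (h₁ c hc) (h₂ c hc)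
      sup := fun h₁ h₂ c hc => c.sup (h₁ c hc) (h₂ c hc)
      iff_forall_φ := fun x y =>
        ⟨fun h i c hc => (c.iff_forall_φ x y).1 (h c hc) i,
          fun h c hc => (c.iff_forall_φ x y).2 fun i => h i c hc⟩ }

/-- The lattice `Con_{θLM_θ}(A)`: meets are intersections, and the join of two `θ`-congruences is
the least `θ`-congruence that contains both. -/
instance : CompleteLattice (ThetaCon I A) :=
  completeLatticeOfInf _ fun _ =>
    ⟨fun c hc _ _ h => h c hc, fun _ hd _ _ h _ hc => hd hc h⟩

end ThetaCon

/-- The congruence `c` is a Boolean `θ`-congruence: it is (as a relation) a `θ`-congruence that is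
a complemented element of the lattice `Con_{θLM_θ}(A)`. -/
def LMCon.IsBooleanTheta (c : LMCon I A) : Prop :=
  ∃ d : ThetaCon I A, (∀ x y : A, d.r x y ↔ c.r x y) ∧ IsComplemented d

end Congruences

/-! ### Congruences of bounded distributive lattices -/

section Lattice

variable {A : Type*} [DistribLattice A] [BoundedOrder A]

/-! Both kinds of complemented congruence are exactly the relations `x ⊔ b = y ⊔ b` with `b`
complemented in `A` (`LMCon.isBoolean_iff`, `ThetaCon.isComplemented_iff`), a description that
ignores the ambient lattice. If `b` has complement `b'`, every `φ i` fixes both, so each defines a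
congruence of either kind, and the two are complementary. Conversely, let `d` be a complement of
`c`. In either lattice `c ⊔ d` lies below `SupRel`, so `SupRel` relates `⊥` to `⊤`. This gives `u ⊔
v = ⊤` with `u` null for `c` and `v` null for `d`. Then `b = φ i u` is complemented, `c`-null and
`d`-equal to `⊤`; since `c` and `d` meet in equality, `b` determines `c`. -/

/-- Complements are unique in the quotient by `LatticeCon.ofSup w`; this yields compatibility with
`φbar`. -/
theorem IsCompl.sup_eq_sup_of_sup_eq_sup {p p' q q' w : A} (hp : IsCompl p p') (hq : IsCompl q q')
    (h : p ⊔ w = q ⊔ w) : p' ⊔ w = q' ⊔ w := by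
  have key : ∀ {p p' q q' : A}, IsCompl p p' → IsCompl q q' → p ⊔ w = q ⊔ w → p' ≤ q' ⊔ w := by
    intro p p' q q' hp hq h
    calc p' = p' ⊓ (q ⊔ q') := by rw [hq.sup_eq_top, inf_top_eq]
      _ ≤ p' ⊓ ((p ⊔ w) ⊔ q') :=
        inf_le_inf_left _ (sup_le_sup_right (h ▸ le_sup_left) _)
      _ = p' ⊓ (p ⊔ (q' ⊔ w)) := by rw [sup_assoc, sup_comm w]
      _ = p' ⊓ (q' ⊔ w) := by rw [inf_sup_left, hp.symm.inf_eq_bot, bot_sup_eq]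
      _ ≤ q' ⊔ w := inf_le_right
  exact le_antisymm (sup_le (key hp hq h) le_sup_right) (sup_le (key hq hp h.symm) le_sup_right)

theorem IsCompl.eq_of_sup_eq_sup {b b' x y : A} (hb : IsCompl b b') (h : x ⊔ b = y ⊔ b)
    (h' : x ⊔ b' = y ⊔ b') : x = y := by
  have key : ∀ z : A, z = (z ⊔ b) ⊓ (z ⊔ b') := fun z => by
    rw [← sup_inf_left, hb.inf_eq_bot, sup_bot_eq]
  rw [key x, key y, h, h']

/-- The congruence of `A` that identifies `x` and `y` when `x ⊔ b = y ⊔ b`. -/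
def LatticeCon.ofSup (b : A) : LatticeCon A where
  r x y := x ⊔ b = y ⊔ b
  iseqv := ⟨fun _ => rfl, Eq.symm, Eq.trans⟩
  inf {w x y z} h₁ h₂ := by rw [sup_inf_right, h₁, h₂, ← sup_inf_right]
  sup {w x y z} h₁ h₂ := by rw [sup_sup_distrib_right, h₁, h₂, ← sup_sup_distrib_right]

theorem LatticeCon.r_of_r_bot_top (c : LatticeCon A) (h : c.r ⊥ ⊤) (x y : A) : c.r x y := by
  have key : ∀ z, c.r ⊥ z := fun z => by simpa using c.inf h (c.iseqv.refl z)
  exact c.iseqv.trans (c.iseqv.symm (key x)) (key y)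

/-- A lattice congruence that meets `d` trivially and sends `b` to `⊥` while `d` sends `b` to `⊤`
is determined by `b`. -/
theorem LatticeCon.r_iff_sup_eq_sup {c d : LatticeCon A} (hcd : ∀ x y, c.r x y → d.r x y → x = y)
    {b : A} (hc : c.r ⊥ b) (hd : d.r ⊤ b) (x y : A) : c.r x y ↔ x ⊔ b = y ⊔ b := by
  constructor
  · intro h
    have key : ∀ z, d.r (z ⊔ b) ⊤ := fun z => by
      simpa using d.sup (d.iseqv.refl z) (d.iseqv.symm hd)
    exact hcd _ _ (c.sup h (c.iseqv.refl b)) (d.iseqv.trans (key x) (d.iseqv.symm (key y)))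
  · intro h
    have key : ∀ z, c.r z (z ⊔ b) := fun z => by simpa using c.sup (c.iseqv.refl z) hc
    exact c.iseqv.trans (key x) (h ▸ c.iseqv.symm (key y))

end Lattice

/-! ### Complemented elements and an upper bound for joins of congruences -/

namespace LMAlgebra

variable {I : Type*} [LinearOrder I] {A : Type*} [DistribLattice A] [BoundedOrder A]
  [LMAlgebra I A]

theorem isCompl_φ_φbar (i : I) (x : A) : IsCompl (φ i x) (φbar i x) :=
  .of_eq (φ_inf_φbar i x) (φ_sup_φbar i x)

theorem isCompl_map_φ {b b' : A} (h : IsCompl b b') (i : I) : IsCompl (φ i b) (φ i b') :=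
  .of_eq (by rw [← map_inf, h.inf_eq_bot, map_bot]) (by rw [← map_sup, h.sup_eq_top, map_top])

/-- Both `φ i b` and its complement `φ i b'` increase with `i`, so `φ i b` is constant in `i`;
determination then applies. -/
theorem φ_eq_self_of_isCompl {b b' : A} (h : IsCompl b b') (i : I) : φ i b = b := by
  have mono : ∀ j k : I, j ≤ k → φ j b = φ k b := fun j k hjk =>
    le_antisymm (φ_mono j k b hjk) <|
      (isCompl_map_φ h j).symm.Antitone (isCompl_map_φ h k).symm (φ_mono j k b' hjk)
  refine determination (I := I) _ _ fun k => ?_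
  rw [φ_φ]
  rcases le_total i k with hik | hik
  · exact mono _ _ hik
  · exact (mono _ _ hik).symm

/-- The relation that identifies `x` and `y` when each `φ i x` and `φ i y` agree modulo the join
of a `c`-null element and a `d`-null element. -/
def SupRel (I : Type*) [LinearOrder I] [LMAlgebra I A] (c d : LatticeCon A) (x y : A) : Prop :=
  ∀ i : I, ∃ u v : A, (c.r ⊥ u ∧ d.r ⊥ v) ∧ φ i x ⊔ (u ⊔ v) = φ i y ⊔ (u ⊔ v)

/-- Null elements are closed under joins, so the two pairs of witnesses can be merged. -/
theorem exists_common_null {c d : LatticeCon A} {p q p' q' : A}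
    (h : ∃ u v : A, (c.r ⊥ u ∧ d.r ⊥ v) ∧ p ⊔ (u ⊔ v) = q ⊔ (u ⊔ v))
    (h' : ∃ u v : A, (c.r ⊥ u ∧ d.r ⊥ v) ∧ p' ⊔ (u ⊔ v) = q' ⊔ (u ⊔ v)) :
    ∃ u v : A, (c.r ⊥ u ∧ d.r ⊥ v) ∧ p ⊔ (u ⊔ v) = q ⊔ (u ⊔ v) ∧
      p' ⊔ (u ⊔ v) = q' ⊔ (u ⊔ v) := by
  obtain ⟨u, v, ⟨hu, hv⟩, e⟩ := h
  obtain ⟨u', v', ⟨hu', hv'⟩, e'⟩ := h'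
  refine ⟨u ⊔ u', v ⊔ v', ⟨by simpa using c.sup hu hu', by simpa using d.sup hv hv'⟩, ?_, ?_⟩
  · rw [sup_sup_sup_comm, ← sup_assoc, e, sup_assoc]
  · rw [sup_sup_sup_comm, sup_comm (u ⊔ v), ← sup_assoc, e', sup_assoc]

/-- `SupRel` as a lattice congruence. -/
def supCon (I : Type*) [LinearOrder I] [LMAlgebra I A] (c d : LatticeCon A) : LatticeCon A where
  r := SupRel I c d
  iseqv := by
    refine ⟨fun x i => ⟨⊥, ⊥, ⟨c.iseqv.refl _, d.iseqv.refl _⟩, rfl⟩, fun h i => ?_,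
      fun h h' i => ?_⟩
    · obtain ⟨u, v, huv, e⟩ := h i
      exact ⟨u, v, huv, e.symm⟩
    · obtain ⟨u, v, huv, e, e'⟩ := exists_common_null (h i) (h' i)
      exact ⟨u, v, huv, e.trans e'⟩
  inf h h' i := by
    obtain ⟨u, v, huv, e, e'⟩ := exists_common_null (h i) (h' i)
    exact ⟨u, v, huv, by rw [map_inf, map_inf, sup_inf_right, e, e', ← sup_inf_right]⟩
  sup h h' i := by
    obtain ⟨u, v, huv, e, e'⟩ := exists_common_null (h i) (h' i)
    exact ⟨u, v, huv, by
      rw [map_sup, map_sup, sup_sup_distrib_right, e, e', ← sup_sup_distrib_right]⟩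

theorem exists_null_sup_eq {c : LatticeCon A} {x y : A} {i : I} (h : c.r (φ i x) (φ i y)) :
    ∃ u, c.r ⊥ u ∧ φ i x ⊔ u = φ i y ⊔ u := by
  have hx := isCompl_φ_φbar i x
  have hy := isCompl_φ_φbar i y
  have key : ∀ {p q q' : A}, IsCompl q q' → c.r p q → c.r ⊥ (p ⊓ q') := fun {p q q'} hq h => by
    simpa [hq.inf_eq_bot] using c.iseqv.symm (c.inf h (c.iseqv.refl q'))
  have join : ∀ {p q q' : A}, IsCompl q q' → q ⊔ (p ⊓ q') = p ⊔ q := fun {p q q'} hq => by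
    rw [sup_inf_left, hq.sup_eq_top, inf_top_eq, sup_comm]
  -- The symmetric difference of the complemented elements `φ i x` and `φ i y`.
  refine ⟨(φ i x ⊓ φbar i y) ⊔ (φ i y ⊓ φbar i x), ?_, ?_⟩
  · simpa using c.sup (key hy h) (key hx (c.iseqv.symm h))
  · rw [← sup_assoc, sup_inf_self, join hx, sup_comm (φ i x ⊓ φbar i y), ← sup_assoc,
      sup_inf_self, join hy, sup_comm]

theorem SupRel.of_left {c d : LatticeCon A} {x y : A} (h : ∀ i : I, c.r (φ i x) (φ i y)) :
    SupRel I c d x y := fun i => by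
  obtain ⟨u, hu, e⟩ := exists_null_sup_eq (h i)
  exact ⟨u, ⊥, ⟨hu, d.iseqv.refl _⟩, by simpa using e⟩

theorem SupRel.of_right {c d : LatticeCon A} {x y : A} (h : ∀ i : I, d.r (φ i x) (φ i y)) :
    SupRel I c d x y := fun i => by
  obtain ⟨v, hv, e⟩ := exists_null_sup_eq (h i)
  exact ⟨⊥, v, ⟨c.iseqv.refl _, hv⟩, by simpa using e⟩

variable (I) in
/-- `SupRel` as an `LM_θ`-congruence. -/
def supLMCon (c d : LatticeCon A) : LMCon I A where
  __ := supCon I c d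
  φ j x y h i := by simpa only [φ_φ] using h j
  φbar j x y h i := by
    obtain ⟨u, v, huv, e⟩ := h j
    refine ⟨u, v, huv, ?_⟩
    rw [φ_eq_self_of_isCompl (isCompl_φ_φbar j x).symm,
      φ_eq_self_of_isCompl (isCompl_φ_φbar j y).symm]
    exact (isCompl_φ_φbar j x).sup_eq_sup_of_sup_eq_sup (isCompl_φ_φbar j y) e

variable (I) in
/-- `SupRel` as a `θ`-congruence. -/
def supThetaCon [Nonempty I] (c d : LatticeCon A) : ThetaCon I A where
  __ := supCon I c d
  iff_forall_φ x y := by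
    refine ⟨fun h j i => by simpa only [φ_φ] using h j, fun h i => ?_⟩
    -- The diagonal instance suffices, since `φ i (φ i x) = φ i x`.
    simpa only [φ_φ] using h i i

/-- If `SupRel` is the full relation, then a complemented element separates `c` from `d`. -/
theorem SupRel.exists_isCompl [Nonempty I] {c d : LatticeCon A}
    (hc : ∀ (i : I) {x y}, c.r x y → c.r (φ i x) (φ i y))
    (hd : ∀ (i : I) {x y}, d.r x y → d.r (φ i x) (φ i y))
    (h : SupRel I c d ⊥ ⊤) : ∃ b b' : A, IsCompl b b' ∧ c.r ⊥ b ∧ d.r ⊤ b := by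
  obtain ⟨i⟩ := ‹Nonempty I›
  obtain ⟨u, v, ⟨hu, hv⟩, e⟩ := h i
  -- Here `e` amounts to `u ⊔ v = ⊤`. Applying `φ i` keeps this and makes the first term
  -- complemented.
  have htop : φ i u ⊔ φ i v = ⊤ := by
    simpa using congrArg (φ i) e
  refine ⟨φ i u, φbar i u, isCompl_φ_φbar i u, by simpa using hc i hu, ?_⟩
  have := d.sup (d.iseqv.refl (φ i u)) (hd i hv)
  rw [htop, map_bot, sup_bot_eq] at this
  exact d.iseqv.symm this

end LMAlgebra

/-! ### Complemented congruences come from complemented elements -/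

section Complemented

open LMAlgebra

variable {I : Type*} [LinearOrder I] {A : Type*} [DistribLattice A] [BoundedOrder A]
  [LMAlgebra I A]

namespace LMCon

theorem eq_bot_iff {c : LMCon I A} : c = ⊥ ↔ ∀ x y, c.r x y → x = y := by
  let e : LMCon I A :=
    { r := Eq
      iseqv := eq_equivalence
      inf := by rintro _ _ _ _ rfl rfl; rfl
      sup := by rintro _ _ _ _ rfl rfl; rfl
      φ := by rintro _ _ _ rfl; rfl
      φbar := by rintro _ _ _ rfl; rfl }
  constructor
  · rintro rfl x y h
    exact (bot_le : ⊥ ≤ e) h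
  · intro h
    exact le_bot_iff.1 fun x y hxy => h x y hxy ▸ (⊥ : LMCon I A).iseqv.refl x

theorem eq_top_iff {c : LMCon I A} : c = ⊤ ↔ c.r ⊥ ⊤ := by
  let e : LMCon I A :=
    { r := fun _ _ => True
      iseqv := ⟨fun _ => trivial, fun _ => trivial, fun _ _ => trivial⟩
      inf := fun _ _ => trivial
      sup := fun _ _ => trivial
      φ := fun _ _ _ _ => trivial
      φbar := fun _ _ _ _ => trivial }
  constructor
  · rintro rfl
    exact (le_top : e ≤ ⊤) trivial
  · intro h
    exact top_le_iff.1 fun x y _ => c.toLatticeCon.r_of_r_bot_top h x y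

/-- For complemented `b`, the relation `x ⊔ b = y ⊔ b` as an `LM_θ`-congruence. -/
def ofSup {b b' : A} (hb : IsCompl b b') : LMCon I A where
  __ := LatticeCon.ofSup b
  φ i x y h := by
    change LMAlgebra.φ i x ⊔ b = LMAlgebra.φ i y ⊔ b
    simpa only [map_sup, φ_eq_self_of_isCompl hb] using congrArg (LMAlgebra.φ i) h
  φbar i x y h := by
    refine (isCompl_φ_φbar i x).sup_eq_sup_of_sup_eq_sup (isCompl_φ_φbar i y) ?_
    simpa only [map_sup, φ_eq_self_of_isCompl hb] using congrArg (LMAlgebra.φ i) h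

theorem isCompl_ofSup {b b' : A} (hb : IsCompl b b') :
    IsCompl (ofSup hb : LMCon I A) (ofSup hb.symm) := by
  refine .of_eq (eq_bot_iff.2 fun x y h => ?_) (eq_top_iff.2 ?_)
  · exact hb.eq_of_sup_eq_sup ((inf_le_left : _ ≤ (ofSup hb : LMCon I A)) h)
      ((inf_le_right : _ ≤ (ofSup hb.symm : LMCon I A)) h)
  · refine Setoid.trans' _ ((le_sup_left : (ofSup hb : LMCon I A) ≤ _) (?_ : ⊥ ⊔ b = b ⊔ b))
      ((le_sup_right : (ofSup hb.symm : LMCon I A) ≤ _) (?_ : b ⊔ b' = ⊤ ⊔ b'))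
    · simp
    · simp [hb.sup_eq_top]

theorem le_supLMCon (c d : LMCon I A) : c ⊔ d ≤ supLMCon I c.toLatticeCon d.toLatticeCon :=
  sup_le (fun _ _ h => .of_left fun i => c.φ i h) (fun _ _ h => .of_right fun i => d.φ i h)

theorem isBoolean_iff [Nonempty I] (c : LMCon I A) :
    c.IsBoolean ↔ ∃ b b' : A, IsCompl b b' ∧ ∀ x y, c.r x y ↔ x ⊔ b = y ⊔ b := by
  constructor
  · rintro ⟨d, hcd⟩
    obtain ⟨b, b', hb, hcb, hdb⟩ :=
      SupRel.exists_isCompl c.φ d.φ (le_supLMCon c d (eq_top_iff.1 hcd.sup_eq_top))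
    refine ⟨b, b', hb, LatticeCon.r_iff_sup_eq_sup (d := d.toLatticeCon) (fun x y h h' => ?_)
      hcb hdb⟩
    -- The intersection as a concrete relation; it lies below `c ⊓ d = ⊥`.
    let e : LMCon I A :=
      { r := fun x y => c.r x y ∧ d.r x y
        iseqv := ⟨fun x => ⟨c.iseqv.refl x, d.iseqv.refl x⟩,
          fun h => ⟨c.iseqv.symm h.1, d.iseqv.symm h.2⟩,
          fun h h' => ⟨c.iseqv.trans h.1 h'.1, d.iseqv.trans h.2 h'.2⟩⟩
        inf := fun h h' => ⟨c.inf h.1 h'.1, d.inf h.2 h'.2⟩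
        sup := fun h h' => ⟨c.sup h.1 h'.1, d.sup h.2 h'.2⟩
        φ := fun i _ _ h => ⟨c.φ i h.1, d.φ i h.2⟩
        φbar := fun i _ _ h => ⟨c.φbar i h.1, d.φbar i h.2⟩ }
    exact eq_bot_iff.1 hcd.inf_eq_bot x y
      ((le_inf (fun _ _ h => h.1) (fun _ _ h => h.2) : e ≤ c ⊓ d) ⟨h, h'⟩)
  · rintro ⟨b, b', hb, h⟩
    obtain rfl : c = ofSup hb := ext_rel h
    exact ⟨_, isCompl_ofSup hb⟩

end LMCon

namespace ThetaCon

theorem φ (c : ThetaCon I A) (i : I) {x y : A} (h : c.r x y) :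
    c.r (LMAlgebra.φ i x) (LMAlgebra.φ i y) :=
  (c.iff_forall_φ x y).1 h i

theorem eq_bot_iff {c : ThetaCon I A} : c = ⊥ ↔ ∀ x y, c.r x y → x = y := by
  let e : ThetaCon I A :=
    { r := Eq
      iseqv := eq_equivalence
      inf := by rintro _ _ _ _ rfl rfl; rfl
      sup := by rintro _ _ _ _ rfl rfl; rfl
      iff_forall_φ := fun x y => ⟨fun h _ => h ▸ rfl, determination x y⟩ }
  constructor
  · rintro rfl x y h
    exact (bot_le : ⊥ ≤ e) h
  · intro h
    exact le_bot_iff.1 fun x y hxy => h x y hxy ▸ (⊥ : ThetaCon I A).iseqv.refl x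

theorem eq_top_iff {c : ThetaCon I A} : c = ⊤ ↔ c.r ⊥ ⊤ := by
  let e : ThetaCon I A :=
    { r := fun _ _ => True
      iseqv := ⟨fun _ => trivial, fun _ => trivial, fun _ _ => trivial⟩
      inf := fun _ _ => trivial
      sup := fun _ _ => trivial
      iff_forall_φ := fun _ _ => ⟨fun _ _ => trivial, fun _ => trivial⟩ }
  constructor
  · rintro rfl
    exact (le_top : e ≤ ⊤) trivial
  · intro h
    exact top_le_iff.1 fun x y _ => c.toLatticeCon.r_of_r_bot_top h x y

/-- For complemented `b`, the relation `x ⊔ b = y ⊔ b` as a `θ`-congruence. -/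
def ofSup {b b' : A} (hb : IsCompl b b') : ThetaCon I A where
  __ := LatticeCon.ofSup b
  iff_forall_φ x y := by
    -- As `φ i` fixes `b`, the equivalence becomes determination for `x ⊔ b` and `y ⊔ b`.
    have key : ∀ (i : I) (z : A), LMAlgebra.φ i z ⊔ b = LMAlgebra.φ i (z ⊔ b) := fun i z => by
      rw [map_sup, φ_eq_self_of_isCompl hb]
    change x ⊔ b = y ⊔ b ↔ ∀ i : I, LMAlgebra.φ i x ⊔ b = LMAlgebra.φ i y ⊔ b
    simp only [key]
    exact ⟨fun h _ => h ▸ rfl, determination _ _⟩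

theorem isCompl_ofSup {b b' : A} (hb : IsCompl b b') :
    IsCompl (ofSup hb : ThetaCon I A) (ofSup hb.symm) := by
  refine .of_eq (eq_bot_iff.2 fun x y h => ?_) (eq_top_iff.2 ?_)
  · exact hb.eq_of_sup_eq_sup ((inf_le_left : _ ≤ (ofSup hb : ThetaCon I A)) h)
      ((inf_le_right : _ ≤ (ofSup hb.symm : ThetaCon I A)) h)
  · refine Setoid.trans' _ ((le_sup_left : (ofSup hb : ThetaCon I A) ≤ _) (?_ : ⊥ ⊔ b = b ⊔ b))
      ((le_sup_right : (ofSup hb.symm : ThetaCon I A) ≤ _) (?_ : b ⊔ b' = ⊤ ⊔ b'))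
    · simp
    · simp [hb.sup_eq_top]

theorem le_supThetaCon [Nonempty I] (c d : ThetaCon I A) :
    c ⊔ d ≤ supThetaCon I c.toLatticeCon d.toLatticeCon :=
  sup_le (fun _ _ h => .of_left fun i => c.φ i h) (fun _ _ h => .of_right fun i => d.φ i h)

theorem isComplemented_iff [Nonempty I] (c : ThetaCon I A) :
    IsComplemented c ↔ ∃ b b' : A, IsCompl b b' ∧ ∀ x y, c.r x y ↔ x ⊔ b = y ⊔ b := by
  constructor
  · rintro ⟨d, hcd⟩
    obtain ⟨b, b', hb, hcb, hdb⟩ :=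
      SupRel.exists_isCompl c.φ d.φ (le_supThetaCon c d (eq_top_iff.1 hcd.sup_eq_top))
    refine ⟨b, b', hb, LatticeCon.r_iff_sup_eq_sup (d := d.toLatticeCon) (fun x y h h' => ?_)
      hcb hdb⟩
    let e : ThetaCon I A :=
      { r := fun x y => c.r x y ∧ d.r x y
        iseqv := ⟨fun x => ⟨c.iseqv.refl x, d.iseqv.refl x⟩,
          fun h => ⟨c.iseqv.symm h.1, d.iseqv.symm h.2⟩,
          fun h h' => ⟨c.iseqv.trans h.1 h'.1, d.iseqv.trans h.2 h'.2⟩⟩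
        inf := fun h h' => ⟨c.inf h.1 h'.1, d.inf h.2 h'.2⟩
        sup := fun h h' => ⟨c.sup h.1 h'.1, d.sup h.2 h'.2⟩
        iff_forall_φ := fun x y => by
          rw [c.iff_forall_φ, d.iff_forall_φ, forall_and] }
    exact eq_bot_iff.1 hcd.inf_eq_bot x y
      ((le_inf (fun _ _ h => h.1) (fun _ _ h => h.2) : e ≤ c ⊓ d) ⟨h, h'⟩)
  · rintro ⟨b, b', hb, h⟩
    obtain rfl : c = ofSup hb := ext_rel h
    exact ⟨_, isCompl_ofSup hb⟩

end ThetaCon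

end Complemented

theorem mainTheorem9 {I : Type*} [LinearOrder I] [Nonempty I] {A : Type*} [DistribLattice A]
    [BoundedOrder A] [LMAlgebra I A] (c : LMCon I A) :
    c.IsBoolean ↔ c.IsBooleanTheta := by
  rw [LMCon.isBoolean_iff]
  constructor
  · rintro ⟨b, b', hb, h⟩
    exact ⟨.ofSup hb, fun x y => (h x y).symm, _, ThetaCon.isCompl_ofSup hb⟩
  · rintro ⟨d, hdc, hd⟩
    obtain ⟨b, b', hb, h⟩ := (ThetaCon.isComplemented_iff d).1 hd
    exact ⟨b, b', hb, fun x y => (hdc x y).symm.trans (h x y)⟩
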